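/- For $\alpha,\beta\in\mathbb{R}$ let $\Phi_{\alpha,\beta}(\rho)=A_1\rho A_1^*+A_2\rho A_2^*$ be the qubit channel on $2\times 2$ complex matrices with Kraus operators $$A_1=\begin{pmatrix}\cos\alpha&0\\0&\cos\beta\end{pmatrix},\qquad A_2=\begin{pmatrix}0&\sin\beta\\\sin\alpha&0\end{pmatrix},$$ and suppose that its Choi matrix $\sum_{i,j}E_{ij}\otimes\Phi_{\alpha,\beta}(E_{ij})$ has rank $2$. Then $\Phi_{\alpha,\beta}$ is degradable if and only if $\cos(2\alpha)\cos(2\beta)\ge 0$. Here a quantum channel is a completely positive trace-preserving linear map between complex matrix algebras. Channels $\Phi$ from $\mathcal{L}(\mathcal{X})$ to $\mathcal{L}(\mathcal{Y})$ and $\widetilde\Phi$ from $\mathcal{L}(\mathcal{X})$ to $\mathcal{L}(\mathcal{Z})$, with $\mathcal{X},\mathcal{Y},\mathcal{Z}$ finite-dimensional, are complementary if there is an isometry $V:\mathcal{X}\to\mathcal{Y}\otimes\mathcal{Z}$ with $\Phi(\rho)=\operatorname{tr}_{\mathcal{Z}}(V\rho V^*)$ and $\widetilde\Phi(\rho)=\operatorname{tr}_{\mathcal{Y}}(V\rho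 V^*)$ for all $\rho$; and $\Phi$ is degradable if there are a channel $\widetilde\Phi$ complementary to $\Phi$ and a channel $\Gamma$ with $\widetilde\Phi=\Gamma\circ\Phi$. -/

import Mathlib

open Matrix

noncomputable section

namespace QubitChannel

open scoped ComplexOrder

/-- `id_k ⊗ Φ`, acting on `k × k` block matrices by applying `Φ` to every block. -/
def ampliation {X Y : Type} (k : ℕ)
    (Φ : Matrix X X ℂ →ₗ[ℂ] Matrix Y Y ℂ) (M : Matrix (Fin k × X) (Fin k × X) ℂ) :
    Matrix (Fin k × Y) (Fin k × Y) ℂ :=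
  Matrix.of fun p q => Φ (Matrix.of fun i j => M (p.1, i) (q.1, j)) p.2 q.2

/-- Complete positivity: `id_k ⊗ Φ` preserves positive semidefiniteness for every `k`. -/
def IsCompletelyPositive {X Y : Type}
    (Φ : Matrix X X ℂ →ₗ[ℂ] Matrix Y Y ℂ) : Prop :=
  ∀ (k : ℕ) (M : Matrix (Fin k × X) (Fin k × X) ℂ), M.PosSemidef → (ampliation k Φ M).PosSemidef

/-- A quantum channel: a completely positive trace-preserving linear map. -/
structure IsChannel {X Y : Type} [Fintype X] [Fintype Y]
    (Φ : Matrix X X ℂ →ₗ[ℂ] Matrix Y Y ℂ) : Prop where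
  completelyPositive : IsCompletelyPositive Φ
  trace_preserving : ∀ ρ, (Φ ρ).trace = ρ.trace

/-- The partial trace over the second tensor factor. -/
def traceSnd {Y Z : Type} [Fintype Z] (M : Matrix (Y × Z) (Y × Z) ℂ) : Matrix Y Y ℂ :=
  Matrix.of fun i j => ∑ z, M (i, z) (j, z)

/-- The partial trace over the first tensor factor. -/
def traceFst {Y Z : Type} [Fintype Y] (M : Matrix (Y × Z) (Y × Z) ℂ) : Matrix Z Z ℂ :=
  Matrix.of fun i j => ∑ y, M (y, i) (y, j)

/-- `Φ` and `Ψ` are complementary: the two marginals of one isometry `V : X → Y ⊗ Z`. -/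
def IsComplementary {X Y Z : Type} [Fintype X] [DecidableEq X] [Fintype Y] [Fintype Z]
    (Φ : Matrix X X ℂ →ₗ[ℂ] Matrix Y Y ℂ) (Ψ : Matrix X X ℂ →ₗ[ℂ] Matrix Z Z ℂ) : Prop :=
  ∃ V : Matrix (Y × Z) X ℂ, Vᴴ * V = 1 ∧
    (∀ ρ, Φ ρ = traceSnd (V * ρ * Vᴴ)) ∧ (∀ ρ, Ψ ρ = traceFst (V * ρ * Vᴴ))

/-- `Φ` is degradable: a complementary channel of `Φ` (with some environment `ℂ^d`) equals
`Γ ∘ Φ` for some quantum channel `Γ`. -/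
def IsDegradable {X Y : Type} [Fintype X] [DecidableEq X] [Fintype Y]
    (Φ : Matrix X X ℂ →ₗ[ℂ] Matrix Y Y ℂ) : Prop :=
  ∃ (d : ℕ) (Ψ : Matrix X X ℂ →ₗ[ℂ] Matrix (Fin d) (Fin d) ℂ)
    (Γ : Matrix Y Y ℂ →ₗ[ℂ] Matrix (Fin d) (Fin d) ℂ),
    IsComplementary Φ Ψ ∧ IsChannel Γ ∧ Ψ = Γ ∘ₗ Φ

/-- The Choi matrix `∑ i j, E_{ij} ⊗ Φ(E_{ij})`. -/
def choiMatrix {X Y : Type} [DecidableEq X]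
    (Φ : Matrix X X ℂ →ₗ[ℂ] Matrix Y Y ℂ) : Matrix (X × Y) (X × Y) ℂ :=
  Matrix.of fun p q => Φ (Matrix.single p.1 q.1 1) p.2 q.2

/-- The linear map `ρ ↦ ∑ i, K i * ρ * (K i)ᴴ` with Kraus operators `K i`. -/
def krausMap {X Y ι : Type} [Fintype X] [Fintype ι] (K : ι → Matrix Y X ℂ) :
    Matrix X X ℂ →ₗ[ℂ] Matrix Y Y ℂ where
  toFun ρ := ∑ i, K i * ρ * (K i)ᴴ
  map_add' ρ σ := by simp [Matrix.mul_add, Matrix.add_mul, Finset.sum_add_distrib]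
  map_smul' c ρ := by simp [Finset.smul_sum]

/-- The two Kraus operators with angles `α` and `β`. -/
def qubitKraus (α β : ℝ) : Fin 2 → Matrix (Fin 2) (Fin 2) ℂ :=
  ![!![(Real.cos α : ℂ), 0; 0, (Real.cos β : ℂ)],
    !![0, (Real.sin β : ℂ); (Real.sin α : ℂ), 0]]

end QubitChannel

end

/-!
All Kraus families of a completely positive map span the same space, namely the range of its Choi
matrix. Hence any complement of `Φ` can be carried to the complement `Φᶜ` of a given Kraus family by
compressing the environment, and degradability yields a completely positive `Γ` with `Γ ∘ Φ = Φᶜ`.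

For Kraus operators `diag(a, b)` and `antidiag(t, s)`, both `Φ` and `Φᶜ` act on diagonal matrices
by stochastic matrices, with columns `(|a|², |s|²), (|t|², |b|²)` and `(|a|², |s|²), (|b|², |t|²)`.
The action of `Γ` on populations is a nonnegative matrix carrying the first to the second, and by
Cramer's rule `|a|² - |s|²` and `|b|² - |t|²` are nonnegative multiples of one determinant.

Conversely, composing `Φ` with the map of the same shape with parameters `(c b, c t, d s, d a)`
gives `Φᶜ`, provided this map is trace preserving. That is a linear system in `|c|²` and `|d|²`,
which has a nonnegative solution when `|a|² - |s|²` and `|b|² - |t|²` lie on a common ray.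
-/

noncomputable section

namespace QubitChannel

open scoped ComplexConjugate ComplexOrder Kronecker

variable {X Y Z ι κ : Type}

theorem IsCompletelyPositive.comp {Ψ : Matrix Y Y ℂ →ₗ[ℂ] Matrix Z Z ℂ}
    {Φ : Matrix X X ℂ →ₗ[ℂ] Matrix Y Y ℂ} (hΨ : IsCompletelyPositive Ψ)
    (hΦ : IsCompletelyPositive Φ) : IsCompletelyPositive (Ψ ∘ₗ Φ) :=
  fun k M hM => hΨ k _ (hΦ k M hM)

theorem IsCompletelyPositive.map_posSemidef {Φ : Matrix X X ℂ →ₗ[ℂ] Matrix Y Y ℂ}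
    (hΦ : IsCompletelyPositive Φ) {ρ : Matrix X X ℂ} (hρ : ρ.PosSemidef) : (Φ ρ).PosSemidef :=
  (hΦ 1 (ρ.submatrix Prod.snd Prod.snd) (hρ.submatrix _)).submatrix fun y => ((0 : Fin 1), y)

section KrausMap

variable [Fintype X] [Fintype ι]

theorem krausMap_apply (K : ι → Matrix Y X ℂ) (ρ : Matrix X X ℂ) :
    krausMap K ρ = ∑ i, K i * ρ * (K i)ᴴ := rfl

theorem ampliation_krausMap (K : ι → Matrix Y X ℂ) (k : ℕ)
    (M : Matrix (Fin k × X) (Fin k × X) ℂ) :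
    ampliation k (krausMap K) M = krausMap (fun i => (1 : Matrix (Fin k) (Fin k) ℂ) ⊗ₖ K i) M := by
  ext ⟨p, y⟩ ⟨q, y'⟩
  simp only [ampliation, krausMap_apply, of_apply, Matrix.sum_apply]
  refine Finset.sum_congr rfl fun i _ => ?_
  simp [mul_apply, Fintype.sum_prod_type, one_apply, apply_ite]

theorem isCompletelyPositive_krausMap [Finite Y] (K : ι → Matrix Y X ℂ) :
    IsCompletelyPositive (krausMap K) := fun k M hM => by
  rw [ampliation_krausMap]
  exact posSemidef_sum _ fun i _ => hM.mul_mul_conjTranspose_same _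

theorem trace_krausMap [Fintype Y] (K : ι → Matrix Y X ℂ) (ρ : Matrix X X ℂ) :
    (krausMap K ρ).trace = ((∑ i, (K i)ᴴ * K i) * ρ).trace := by
  simp only [krausMap_apply, trace_sum, Matrix.sum_mul]
  exact Finset.sum_congr rfl fun i _ => by rw [trace_mul_comm, Matrix.mul_assoc]

theorem isChannel_krausMap [DecidableEq X] [Fintype Y] {K : ι → Matrix Y X ℂ}
    (hK : ∑ i, (K i)ᴴ * K i = 1) : IsChannel (krausMap K) where
  completelyPositive := isCompletelyPositive_krausMap K
  trace_preserving ρ := by rw [trace_krausMap, hK, Matrix.one_mul]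

end KrausMap

/-- The Stinespring operator `∑ i, K i ⊗ e_i : X → Y ⊗ ℂ^ι` of a family of Kraus operators. -/
def stinespring (K : ι → Matrix Y X ℂ) : Matrix (Y × ι) X ℂ :=
  of fun p x => K p.2 p.1 x

/-- The complement `ρ ↦ ∑ i j, tr (K i * ρ * (K j)ᴴ) E_{ij}` of the map with Kraus operators `K i`,
obtained by tracing out `Y` in the Stinespring dilation `stinespring K`. -/
def complementMap [Fintype X] [Fintype Y] (K : ι → Matrix Y X ℂ) :
    Matrix X X ℂ →ₗ[ℂ] Matrix ι ι ℂ where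
  toFun ρ := of fun i j => (K i * ρ * (K j)ᴴ).trace
  map_add' ρ σ := by ext; simp [Matrix.mul_add, Matrix.add_mul]
  map_smul' c ρ := by ext; simp

theorem complementMap_apply [Fintype X] [Fintype Y] (K : ι → Matrix Y X ℂ) (ρ : Matrix X X ℂ)
    (i j : ι) : complementMap K ρ i j = (K i * ρ * (K j)ᴴ).trace := rfl

theorem traceSnd_stinespring [Fintype X] [Fintype ι] (K : ι → Matrix Y X ℂ) (ρ : Matrix X X ℂ) :
    traceSnd (stinespring K * ρ * (stinespring K)ᴴ) = krausMap K ρ := by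
  ext y y'
  simp [traceSnd, stinespring, krausMap_apply, Matrix.sum_apply, mul_apply]

theorem traceFst_stinespring [Fintype X] [Fintype Y] (K : ι → Matrix Y X ℂ) (ρ : Matrix X X ℂ) :
    traceFst (stinespring K * ρ * (stinespring K)ᴴ) = complementMap K ρ := by
  ext i j
  simp [traceFst, stinespring, complementMap_apply, trace, mul_apply]

theorem conjTranspose_stinespring_mul_self [Fintype Y] [Fintype ι] (K : ι → Matrix Y X ℂ) :
    (stinespring K)ᴴ * stinespring K = ∑ i, (K i)ᴴ * K i := by
  ext x x'
  simp only [stinespring, mul_apply, conjTranspose_apply, of_apply, Matrix.sum_apply,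
    Fintype.sum_prod_type]
  exact Finset.sum_comm

theorem isComplementary_krausMap_complementMap [Fintype X] [DecidableEq X] [Fintype Y] [Fintype ι]
    {K : ι → Matrix Y X ℂ} (hK : ∑ i, (K i)ᴴ * K i = 1) :
    IsComplementary (krausMap K) (complementMap K) :=
  ⟨stinespring K, (conjTranspose_stinespring_mul_self K).trans hK,
    fun ρ => (traceSnd_stinespring K ρ).symm, fun ρ => (traceFst_stinespring K ρ).symm⟩

theorem IsComplementary.exists_kraus [Fintype X] [DecidableEq X] [Fintype Y] [Fintype Z]
    {Φ : Matrix X X ℂ →ₗ[ℂ] Matrix Y Y ℂ} {Ψ : Matrix X X ℂ →ₗ[ℂ] Matrix Z Z ℂ}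
    (h : IsComplementary Φ Ψ) :
    ∃ B : Z → Matrix Y X ℂ, Φ = krausMap B ∧ Ψ = complementMap B := by
  obtain ⟨V, -, hΦ, hΨ⟩ := h
  let B : Z → Matrix Y X ℂ := fun z => of fun y x => V (y, z) x
  have hV : V = stinespring B := rfl
  exact ⟨B, LinearMap.ext fun ρ => by rw [hΦ, hV, traceSnd_stinespring],
    LinearMap.ext fun ρ => by rw [hΨ, hV, traceFst_stinespring]⟩

theorem range_mulVecLin_self_mul_conjTranspose {m n R : Type*} [Fintype m] [Fintype n] [Field R]
    [PartialOrder R] [StarRing R] [StarOrderedRing R] (A : Matrix m n R) :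
    LinearMap.range (A * Aᴴ).mulVecLin = LinearMap.range A.mulVecLin := by
  refine Submodule.eq_of_le_of_finrank_eq ?_ (rank_self_mul_conjTranspose A)
  rw [mulVecLin_mul]
  exact LinearMap.range_comp_le_range _ _

theorem exists_eq_mul_of_self_mul_conjTranspose_eq {m n p R : Type*} [Finite m] [Fintype n]
    [Fintype p] [Field R] [PartialOrder R] [StarRing R] [StarOrderedRing R]
    {A : Matrix m n R} {B : Matrix m p R} (h : A * Aᴴ = B * Bᴴ) :
    ∃ C : Matrix p n R, A = B * C := by
  classical
  cases nonempty_fintype m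
  have hrange : LinearMap.range A.mulVecLin = LinearMap.range B.mulVecLin := by
    rw [← range_mulVecLin_self_mul_conjTranspose, h, range_mulVecLin_self_mul_conjTranspose]
  have hcol (j : n) : ∃ c, B *ᵥ c = A.col j :=
    LinearMap.mem_range.1 (hrange ▸ LinearMap.mem_range.2 ⟨Pi.single j 1, by simp⟩)
  choose c hc using hcol
  exact ⟨of fun i j => c j i, ext fun i j => (congrFun (hc j) i).symm⟩

theorem choiMatrix_krausMap [Fintype X] [DecidableEq X] [Fintype ι] (K : ι → Matrix Y X ℂ) :
    choiMatrix (krausMap K) = (of fun i => vec (K i))ᵀ * (of fun i => vec (K i))ᵀᴴ := by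
  ext ⟨x, y⟩ ⟨x', y'⟩
  simp only [choiMatrix, krausMap_apply, of_apply, Matrix.sum_apply]
  rw [mul_apply]
  refine Finset.sum_congr rfl fun i _ => ?_
  simp [mul_apply, single_apply, ite_and, vec]

theorem exists_eq_sum_smul_of_krausMap_eq [Fintype X] [Finite Y] [Fintype ι]
    [Fintype κ] {K : ι → Matrix Y X ℂ} {B : κ → Matrix Y X ℂ} (h : krausMap K = krausMap B) :
    ∃ C : Matrix ι κ ℂ, ∀ i, K i = ∑ z, C i z • B z := by
  classical
  have hchoi := congrArg choiMatrix h
  rw [choiMatrix_krausMap, choiMatrix_krausMap] at hchoi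
  obtain ⟨C, hC⟩ := exists_eq_mul_of_self_mul_conjTranspose_eq hchoi
  refine ⟨Cᵀ, fun i => ext fun y x => ?_⟩
  simpa [mul_apply, Matrix.sum_apply, mul_comm] using congrFun₂ hC (x, y) i

theorem complementMap_sum_smul [Fintype X] [Fintype Y] [Fintype κ] (C : Matrix ι κ ℂ)
    (B : κ → Matrix Y X ℂ) (ρ : Matrix X X ℂ) :
    complementMap (fun i => ∑ z, C i z • B z) ρ = C * complementMap B ρ * Cᴴ := by
  ext i j
  simp only [complementMap_apply, mul_apply, conjTranspose_apply, conjTranspose_sum,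
    conjTranspose_smul, Matrix.sum_mul, Matrix.mul_sum, Matrix.smul_mul, Matrix.mul_smul,
    trace_sum, trace_smul, smul_eq_mul, Finset.mul_sum, Finset.sum_mul]
  exact Finset.sum_congr rfl fun z _ => Finset.sum_congr rfl fun z' _ => by ring

theorem IsDegradable.exists_comp_krausMap_eq_complementMap [Fintype X] [DecidableEq X] [Fintype Y]
    [Fintype ι] {K : ι → Matrix Y X ℂ} (h : IsDegradable (krausMap K)) :
    ∃ Γ : Matrix Y Y ℂ →ₗ[ℂ] Matrix ι ι ℂ,
      IsCompletelyPositive Γ ∧ Γ ∘ₗ krausMap K = complementMap K := by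
  obtain ⟨d, Ψ, Γ, hcompl, hΓ, rfl⟩ := h
  obtain ⟨B, hB, hΨ⟩ := hcompl.exists_kraus
  obtain ⟨C, hC⟩ := exists_eq_sum_smul_of_krausMap_eq hB
  refine ⟨krausMap (fun _ : Unit => C) ∘ₗ Γ,
    (isCompletelyPositive_krausMap _).comp hΓ.completelyPositive, LinearMap.ext fun ρ => ?_⟩
  rw [LinearMap.comp_assoc, hΨ, funext hC, complementMap_sum_smul]
  simp [krausMap_apply]

theorem isDegradable_krausMap_of_comp_eq [Fintype X] [DecidableEq X] [Fintype Y] {d : ℕ}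
    {K : Fin d → Matrix Y X ℂ} (hK : ∑ i, (K i)ᴴ * K i = 1)
    {Γ : Matrix Y Y ℂ →ₗ[ℂ] Matrix (Fin d) (Fin d) ℂ} (hΓ : IsChannel Γ)
    (h : Γ ∘ₗ krausMap K = complementMap K) : IsDegradable (krausMap K) :=
  ⟨d, complementMap K, Γ, isComplementary_krausMap_complementMap hK, hΓ, h.symm⟩

/-- A diagonal and an antidiagonal Kraus operator on a qubit. The order of the antidiagonal entries
makes `a`, `s` the parameters of the first columns and `b`, `t` those of the second ones. -/
def diagAntidiag (a b s t : ℂ) : Fin 2 → Matrix (Fin 2) (Fin 2) ℂ :=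
  ![!![a, 0; 0, b], !![0, t; s, 0]]

variable {a b s t : ℂ}

theorem sum_conjTranspose_mul_diagAntidiag (has : ‖a‖ ^ 2 + ‖s‖ ^ 2 = 1)
    (hbt : ‖b‖ ^ 2 + ‖t‖ ^ 2 = 1) :
    ∑ i, (diagAntidiag a b s t i)ᴴ * diagAntidiag a b s t i = 1 := by
  have has' : (‖a‖ : ℂ) ^ 2 + (‖s‖ : ℂ) ^ 2 = 1 := by exact_mod_cast has
  have hbt' : (‖b‖ : ℂ) ^ 2 + (‖t‖ : ℂ) ^ 2 = 1 := by exact_mod_cast hbt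
  ext i j
  fin_cases i <;> fin_cases j <;>
    simp [diagAntidiag, mul_apply, Complex.conj_mul', has', hbt']

theorem krausMap_diagAntidiag (a b s t : ℂ) (ρ : Matrix (Fin 2) (Fin 2) ℂ) :
    krausMap (diagAntidiag a b s t) ρ =
      !![‖a‖ ^ 2 * ρ 0 0 + ‖t‖ ^ 2 * ρ 1 1, a * conj b * ρ 0 1 + t * conj s * ρ 1 0;
         b * conj a * ρ 1 0 + s * conj t * ρ 0 1, ‖b‖ ^ 2 * ρ 1 1 + ‖s‖ ^ 2 * ρ 0 0] := by
  ext i j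
  fin_cases i <;> fin_cases j <;>
    simp [diagAntidiag, krausMap_apply, vecMul, dotProduct, mul_apply, ← Complex.mul_conj'] <;> ring

theorem complementMap_diagAntidiag (a b s t : ℂ) (ρ : Matrix (Fin 2) (Fin 2) ℂ) :
    complementMap (diagAntidiag a b s t) ρ =
      !![‖a‖ ^ 2 * ρ 0 0 + ‖b‖ ^ 2 * ρ 1 1, a * conj t * ρ 0 1 + b * conj s * ρ 1 0;
         t * conj a * ρ 1 0 + s * conj b * ρ 0 1, ‖t‖ ^ 2 * ρ 1 1 + ‖s‖ ^ 2 * ρ 0 0] := by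
  ext i j
  fin_cases i <;> fin_cases j <;>
    simp [diagAntidiag, complementMap_apply, trace, vecMul, dotProduct, mul_apply,
      ← Complex.mul_conj'] <;> ring

theorem krausMap_diagAntidiag_comp_eq_complementMap {c d : ℂ} (hbs : ‖c * b‖ ^ 2 + ‖d * s‖ ^ 2 = 1)
    (hta : ‖c * t‖ ^ 2 + ‖d * a‖ ^ 2 = 1) :
    krausMap (diagAntidiag (c * b) (c * t) (d * s) (d * a)) ∘ₗ krausMap (diagAntidiag a b s t) =
      complementMap (diagAntidiag a b s t) := by
  have hbs' : (‖c * b‖ : ℂ) ^ 2 + (‖d * s‖ : ℂ) ^ 2 = 1 := by exact_mod_cast hbs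
  have hta' : (‖c * t‖ : ℂ) ^ 2 + (‖d * a‖ : ℂ) ^ 2 = 1 := by exact_mod_cast hta
  refine LinearMap.ext fun ρ => ?_
  rw [LinearMap.comp_apply, complementMap_diagAntidiag, krausMap_diagAntidiag,
    krausMap_diagAntidiag]
  simp only [← Complex.mul_conj', map_mul] at hbs' hta' ⊢
  ext i j
  fin_cases i <;> fin_cases j <;>
    simp only [Fin.zero_eta, Fin.mk_one, of_apply, cons_val_zero, cons_val_one, cons_val_fin_one]
  · linear_combination (a * conj a * ρ 0 0) * hbs' + (b * conj b * ρ 1 1) * hta'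
  · linear_combination (a * conj t * ρ 0 1) * hbs' + (b * conj s * ρ 1 0) * hta'
  · linear_combination (t * conj a * ρ 1 0) * hbs' + (s * conj b * ρ 0 1) * hta'
  · linear_combination (t * conj t * ρ 1 1) * hbs' + (s * conj s * ρ 0 0) * hta'

theorem exists_convex_weights_of_mul_nonneg {R : Type*} [Field R] [LinearOrder R]
    [IsStrictOrderedRing R] {x y : R} (h : 0 ≤ x * y) :
    ∃ k l : R, 0 ≤ k ∧ 0 ≤ l ∧ k + l = 1 ∧ k * y = l * x := by
  have hray : SameRay R x y := by simpa using sameRay_smul_smul_of_mul_nonneg (v := (1 : R)) h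
  obtain ⟨k, l, hk, hl, hkl, hx, hy⟩ := hray.exists_eq_smul_add
  rw [smul_eq_mul] at hx hy
  exact ⟨k, l, hk, hl, hkl, by linear_combination k * hy - l * hx⟩

theorem isDegradable_diagAntidiag_of_nonneg (has : ‖a‖ ^ 2 + ‖s‖ ^ 2 = 1)
    (hbt : ‖b‖ ^ 2 + ‖t‖ ^ 2 = 1) (h : 0 ≤ (‖a‖ ^ 2 - ‖s‖ ^ 2) * (‖b‖ ^ 2 - ‖t‖ ^ 2)) :
    IsDegradable (krausMap (diagAntidiag a b s t)) := by
  obtain ⟨k, l, hk, hl, hkl, hratio⟩ := exists_convex_weights_of_mul_nonneg h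
  have norm_sq_sqrt_mul {r : ℝ} (hr : 0 ≤ r) (z : ℂ) :
      ‖(√(2 * r) : ℂ) * z‖ ^ 2 = 2 * r * ‖z‖ ^ 2 := by
    rw [norm_mul, mul_pow, Complex.norm_real, Real.norm_eq_abs, sq_abs,
      Real.sq_sqrt (by positivity)]
  have hbs : ‖(√(2 * k) : ℂ) * b‖ ^ 2 + ‖(√(2 * l) : ℂ) * s‖ ^ 2 = 1 := by
    rw [norm_sq_sqrt_mul hk, norm_sq_sqrt_mul hl]
    linear_combination hkl + k * hbt + l * has + hratio
  have hta : ‖(√(2 * k) : ℂ) * t‖ ^ 2 + ‖(√(2 * l) : ℂ) * a‖ ^ 2 = 1 := by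
    rw [norm_sq_sqrt_mul hk, norm_sq_sqrt_mul hl]
    linear_combination hkl + k * hbt + l * has - hratio
  exact isDegradable_krausMap_of_comp_eq (sum_conjTranspose_mul_diagAntidiag has hbt)
    (isChannel_krausMap (sum_conjTranspose_mul_diagAntidiag hbs hta))
    (krausMap_diagAntidiag_comp_eq_complementMap hbs hta)

theorem krausMap_diagAntidiag_single_zero (a b s t : ℂ) :
    krausMap (diagAntidiag a b s t) (single 0 0 1) =
      ‖a‖ ^ 2 • single 0 0 1 + ‖s‖ ^ 2 • single 1 1 1 := by
  rw [krausMap_diagAntidiag]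
  ext i j
  fin_cases i <;> fin_cases j <;> simp

theorem krausMap_diagAntidiag_single_one (a b s t : ℂ) :
    krausMap (diagAntidiag a b s t) (single 1 1 1) =
      ‖t‖ ^ 2 • single 0 0 1 + ‖b‖ ^ 2 • single 1 1 1 := by
  rw [krausMap_diagAntidiag]
  ext i j
  fin_cases i <;> fin_cases j <;> simp

theorem posSemidef_single_one {n R : Type*} [DecidableEq n] [Ring R] [PartialOrder R]
    [StarRing R] [StarOrderedRing R] (i : n) : (single i i (1 : R)).PosSemidef := by
  rw [← diagonal_single]
  exact PosSemidef.diagonal (Pi.single_nonneg.2 zero_le_one)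

theorem exists_nonneg_mul_eq_of_comp_krausMap_diagAntidiag_eq
    {Γ : Matrix (Fin 2) (Fin 2) ℂ →ₗ[ℂ] Matrix (Fin 2) (Fin 2) ℂ} (hΓ : IsCompletelyPositive Γ)
    (h : Γ ∘ₗ krausMap (diagAntidiag a b s t) = complementMap (diagAntidiag a b s t)) :
    ∃ P : Matrix (Fin 2) (Fin 2) ℝ, (∀ i j, 0 ≤ P i j) ∧
      P * !![‖a‖ ^ 2, ‖t‖ ^ 2; ‖s‖ ^ 2, ‖b‖ ^ 2] = !![‖a‖ ^ 2, ‖b‖ ^ 2; ‖s‖ ^ 2, ‖t‖ ^ 2] := by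
  -- The population of level `i` in the image under `Γ` of the `j`-th basis state.
  refine ⟨of fun i j => (Γ (single j j 1) i i).re, fun i j => ?_, ?_⟩
  · exact (Complex.le_def.1 (hΓ.map_posSemidef (posSemidef_single_one j)).diag_nonneg).1
  have hzero := LinearMap.congr_fun h (single 0 0 1)
  have hone := LinearMap.congr_fun h (single 1 1 1)
  simp only [LinearMap.comp_apply, krausMap_diagAntidiag_single_zero,
    krausMap_diagAntidiag_single_one, map_add, LinearMap.map_smul_of_tower,
    complementMap_diagAntidiag] at hzero hone
  ext i j
  fin_cases j
  · have := congrArg Complex.re (congrFun₂ hzero i i)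
    fin_cases i <;> simpa [mul_apply, mul_comm, ← Complex.ofReal_pow] using this
  · have := congrArg Complex.re (congrFun₂ hone i i)
    fin_cases i <;> simpa [mul_apply, mul_comm, ← Complex.ofReal_pow] using this

theorem nonneg_of_isDegradable_diagAntidiag (has : ‖a‖ ^ 2 + ‖s‖ ^ 2 = 1)
    (hbt : ‖b‖ ^ 2 + ‖t‖ ^ 2 = 1) (h : IsDegradable (krausMap (diagAntidiag a b s t))) :
    0 ≤ (‖a‖ ^ 2 - ‖s‖ ^ 2) * (‖b‖ ^ 2 - ‖t‖ ^ 2) := by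
  obtain ⟨Γ, hΓ, hcomp⟩ := h.exists_comp_krausMap_eq_complementMap
  obtain ⟨P, hP, hmul⟩ := exists_nonneg_mul_eq_of_comp_krausMap_diagAntidiag_eq hΓ hcomp
  simp only [← ext_iff, mul_apply, Fin.forall_fin_two, Fin.sum_univ_two, of_apply, cons_val_zero,
    cons_val_one, cons_val_fin_one] at hmul
  obtain ⟨⟨h₀₀, h₀₁⟩, h₁₀, h₁₁⟩ := hmul
  set δ := ‖a‖ ^ 2 * ‖b‖ ^ 2 - ‖s‖ ^ 2 * ‖t‖ ^ 2
  -- Cramer's rule for the entries of `P`, added along each diagonal.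
  have hdiag : ‖a‖ ^ 2 - ‖s‖ ^ 2 = δ * (P 0 0 + P 1 1) := by
    linear_combination (-‖a‖ ^ 2 + ‖s‖ ^ 2) * hbt - ‖b‖ ^ 2 * h₀₀ + ‖s‖ ^ 2 * h₀₁ +
      ‖t‖ ^ 2 * h₁₀ - ‖a‖ ^ 2 * h₁₁
  have hanti : ‖b‖ ^ 2 - ‖t‖ ^ 2 = δ * (P 0 1 + P 1 0) := by
    linear_combination (-‖b‖ ^ 2 + ‖t‖ ^ 2) * has + ‖t‖ ^ 2 * h₀₀ - ‖a‖ ^ 2 * h₀₁ -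
      ‖b‖ ^ 2 * h₁₀ + ‖s‖ ^ 2 * h₁₁
  calc 0 ≤ δ ^ 2 * ((P 0 0 + P 1 1) * (P 0 1 + P 1 0)) := by
        have := hP 0 0; have := hP 0 1; have := hP 1 0; have := hP 1 1
        positivity
    _ = (‖a‖ ^ 2 - ‖s‖ ^ 2) * (‖b‖ ^ 2 - ‖t‖ ^ 2) := by rw [hdiag, hanti]; ring

theorem qubitKraus_eq_diagAntidiag (α β : ℝ) :
    qubitKraus α β = diagAntidiag (Real.cos α) (Real.cos β) (Real.sin α) (Real.sin β) := rfl

theorem norm_cos_sq_add_norm_sin_sq (θ : ℝ) :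
    ‖(Real.cos θ : ℂ)‖ ^ 2 + ‖(Real.sin θ : ℂ)‖ ^ 2 = 1 := by
  simp only [Complex.norm_real, Real.norm_eq_abs, sq_abs, Real.cos_sq_add_sin_sq]

theorem norm_cos_sq_sub_norm_sin_sq (θ : ℝ) :
    ‖(Real.cos θ : ℂ)‖ ^ 2 - ‖(Real.sin θ : ℂ)‖ ^ 2 = Real.cos (2 * θ) := by
  simp only [Complex.norm_real, Real.norm_eq_abs, sq_abs, Real.cos_two_mul']

end QubitChannel

end

theorem mainTheorem3_general {a b s t : ℂ} (has : ‖a‖ ^ 2 + ‖s‖ ^ 2 = 1)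
    (hbt : ‖b‖ ^ 2 + ‖t‖ ^ 2 = 1) :
    QubitChannel.IsDegradable (QubitChannel.krausMap (QubitChannel.diagAntidiag a b s t)) ↔
      0 ≤ (‖a‖ ^ 2 - ‖s‖ ^ 2) * (‖b‖ ^ 2 - ‖t‖ ^ 2) :=
  ⟨QubitChannel.nonneg_of_isDegradable_diagAntidiag has hbt,
    QubitChannel.isDegradable_diagAntidiag_of_nonneg has hbt⟩

theorem mainTheorem3 (α β : ℝ)
    (hrank : (QubitChannel.choiMatrix
      (QubitChannel.krausMap (QubitChannel.qubitKraus α β))).rank = 2) :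
    QubitChannel.IsDegradable (QubitChannel.krausMap (QubitChannel.qubitKraus α β)) ↔
      0 ≤ Real.cos (2 * α) * Real.cos (2 * β) := by
  simpa only [QubitChannel.qubitKraus_eq_diagAntidiag, QubitChannel.norm_cos_sq_sub_norm_sin_sq]
    using mainTheorem3_general (QubitChannel.norm_cos_sq_add_norm_sin_sq α)
      (QubitChannel.norm_cos_sq_add_norm_sin_sq β)
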